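/- Let $X\subseteq 2^\omega$ (with the product topology). For $x\in 2^\omega$ let $C_x=\{x\restriction n : n<\omega\}\subseteq 2^{<\omega}$ be the branch of $x$. Let $\mathcal I_X$ be the ideal on the countable set $2^{<\omega}$ generated by the finite unions of branches $C_x$ with $x\in X$, i.e. the family of all $A\subseteq 2^{<\omega}$ with $A\subseteq\bigcup_{x\in s}C_x$ for some finite $s\subseteq X$, and let $\mathcal F_X=\{2^{<\omega}\setminus A : A\in\mathcal I_X\}$ be the dual filter. Filters on $2^{<\omega}$ are regarded as subspaces of the power set $\mathcal P(2^{<\omega})$, which is identified with the Cantor space $2^{2^{<\omega}}$ through characteristic functions. A set is $F_\sigma$ if it is a countable union of closed sets of the ambient space. A topological space $Y$ is *Menger* if for every sequence $(\mathcal U_n)_{n<\omega}$ of open covers of $Y$ there are finite $\mathcal V_n\subseteq\mathcal U_n$ such that $\bigcup_n\mathcal V_n$ covers $Y$; it is *Hurewicz* if for every such sequence there are finite $\mathcal V_n\subseteq\mathcal U_n$ such that every $y\in Y$ belongs to $\bigcup\mathcal V_n$ for all but finitely many $n$. Let $\mathcal F$ be $\mathcal F_X$, or the filter generated by $\mathcal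 F_X$ together with all cofinite subsets of $2^{<\omega}$. Then (a) $X$ is $F_\sigma$ in $2^\omega$ if and only if $\mathcal F$ is $F_\sigma$ in $\mathcal P(2^{<\omega})$; (b) $X^n$ is Menger for every $0<n<\omega$ if and only if $\mathcal F$ is Menger; (c) $X^n$ is Hurewicz for every $0<n<\omega$ if and only if $\mathcal F$ is Hurewicz. -/

import Mathlib

/-- The set `2^{<ω}` of finite binary sequences: a length `n` and a function from `n` to `2`. -/
abbrev BinTree : Type := Σ n : ℕ, (Fin n → Bool)

/-- The restriction `x ↾ n` of `x ∈ 2^ω`. -/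
def restrictTo (x : ℕ → Bool) (n : ℕ) : BinTree := ⟨n, fun i => x i⟩

/-- The branch `C_x = {x ↾ n : n < ω}`. -/
def branch (x : ℕ → Bool) : Set BinTree := Set.range (restrictTo x)

/-- The ideal `I_X` on `2^{<ω}` generated by the finite unions of branches `C_x`, `x ∈ X`: all
subsets of such unions. -/
def nyikosIdeal (X : Set (ℕ → Bool)) : Set (Set BinTree) :=
  {A | ∃ s : Set (ℕ → Bool), s.Finite ∧ s ⊆ X ∧ A ⊆ ⋃ x ∈ s, branch x}

/-- The filter `F_X` dual to `I_X`. -/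
def nyikosFilter (X : Set (ℕ → Bool)) : Filter BinTree where
  sets := {A | Aᶜ ∈ nyikosIdeal X}
  univ_sets := ⟨∅, Set.finite_empty, Set.empty_subset X, by simp⟩
  sets_of_superset := by
    rintro A B ⟨s, hs, hX, hA⟩ hAB
    exact ⟨s, hs, hX, (Set.compl_subset_compl.mpr hAB).trans hA⟩
  inter_sets := by
    rintro A B ⟨s, hs, hX, hA⟩ ⟨t, ht, hX', hB⟩
    refine ⟨s ∪ t, hs.union ht, Set.union_subset hX hX', ?_⟩
    rw [Set.compl_inter, Set.biUnion_union]
    exact Set.union_subset_union hA hB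

/-- `F_X` is a proper filter, and stays proper when the cofinite sets are adjoined to it. -/
theorem nyikosFilter_inf_cofinite_neBot (X : Set (ℕ → Bool)) :
    (nyikosFilter X ⊓ Filter.cofinite).NeBot := by
  rw [Filter.inf_neBot_iff]
  rintro A ⟨s, hs, -, hA⟩ B hB
  obtain ⟨y, hy⟩ := hs.exists_notMem
  have hne : ∀ x ∈ s, ∃ n, x n ≠ y n := by
    intro x hx
    by_contra! h
    exact hy (funext h ▸ hx)
  choose! d hd using hne
  obtain ⟨N, hN⟩ := (hs.image d).bddAbove
  have hinj : Function.Injective fun k => restrictTo y (N + 1 + k) := by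
    intro a b h
    have := congrArg Sigma.fst h
    simp only [restrictTo] at this
    omega
  have hinf := Set.infinite_range_of_injective hinj
  obtain ⟨t, ⟨k, rfl⟩, hk⟩ := hinf.exists_notMem_finite (Filter.mem_cofinite.mp hB)
  refine ⟨_, ?_, not_not.mp hk⟩
  by_contra hnA
  obtain ⟨x, hx, m, hm⟩ := Set.mem_iUnion₂.mp (hA hnA)
  have hlen : m = N + 1 + k := congrArg Sigma.fst hm
  subst hlen
  have hdN : d x ≤ N := hN ⟨x, hx, rfl⟩
  have heq := eq_of_heq (Sigma.mk.inj hm).2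
  exact hd x hx (congrFun heq ⟨d x, by omega⟩)

/-- A filter on `α` as a subset of the power set of `α`, where the power set is identified, through
characteristic functions, with the product space `2^α` (`Bool` is discrete). -/
def filterSubspace {α : Type*} (F : Filter α) : Set (α → Bool) :=
  {f | {a | f a = true} ∈ F}

/-- `S` is `F_σ`: a countable union of closed sets. -/
def IsFSigma {Y : Type*} [TopologicalSpace Y] (S : Set Y) : Prop :=
  ∃ C : ℕ → Set Y, (∀ n, IsClosed (C n)) ∧ S = ⋃ n, C n

/-- `U` is an open cover of the space `Y`. -/
def IsCoverByOpens {Y : Type*} [TopologicalSpace Y] (U : Set (Set Y)) : Prop :=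
  (∀ u ∈ U, IsOpen u) ∧ ⋃₀ U = Set.univ

/-- The Menger property: from every sequence of open covers one can choose finite subfamilies
whose union is a cover. -/
def IsMenger (Y : Type*) [TopologicalSpace Y] : Prop :=
  ∀ U : ℕ → Set (Set Y), (∀ n, IsCoverByOpens (U n)) →
    ∃ V : ℕ → Set (Set Y), (∀ n, V n ⊆ U n ∧ (V n).Finite) ∧ IsCoverByOpens (⋃ n, V n)

/-- The Hurewicz property: from every sequence of open covers one can choose finite subfamilies
such that every point lies in the union of the `n`-th one for all but finitely many `n`. -/
def IsHurewicz (Y : Type*) [TopologicalSpace Y] : Prop :=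
  ∀ U : ℕ → Set (Set Y), (∀ n, IsCoverByOpens (U n)) →
    ∃ V : ℕ → Set (Set Y), (∀ n, V n ⊆ U n ∧ (V n).Finite) ∧
      ∀ y : Y, {n | y ∉ ⋃₀ V n}.Finite

/-!
The three properties in play (being `σ`-compact, Menger, Hurewicz) pass from spaces `Y i`,
`i` ranging over a countable set, to every space `Z` that is covered by the values of
upper hemicontinuous compact-valued maps `Y i → Set Z` ("usco" maps); this is
`sigmaCompact_stableUnderUsco` and `SelectsCovers.of_usco`, the latter treating the Menger and
Hurewicz properties at once. A closed relation between `Y` and a compact space is such a map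
(`IsUsco.of_isClosed_graph`), and two closed relations connect `X` with the filter `F`.

* Sending `(x₁, …, xₙ) ∈ Xⁿ` to the compact set of all `A` whose complement is contained in
  `E ∪ C_{x₁} ∪ … ∪ C_{xₙ}`, for `n < ω` and for a finite set `E` (empty, if the cofinite sets are
  not adjoined), is a countable family of usco maps whose values cover `F`.
* Sending `A ∈ F` to the compact set of all `(x₁, …, xₙ) ∈ (2^ω)ⁿ` for which the complement of `A`
  equals `C_{x₁} ∪ … ∪ C_{xₙ}` is a usco map whose values cover `Xⁿ`. The values are contained in
  `Xⁿ`, because a branch that is covered by a finite set and finitely many other branches is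
  one of those branches (`mem_of_branch_subset`).

Hence all powers `Xⁿ` have the property if and only if `F` has it (`StableUnderUsco.forall_pow_iff`).
In a compact Hausdorff space the `F_σ` subsets are the `σ`-compact ones, and `σ`-compactness is
inherited by finite powers, which gives the `F_σ` equivalence.
-/

open Set Topology

/-! ### Compact-valued upper hemicontinuous maps -/

/-- A set-valued map is usco if it is upper hemicontinuous with compact values. Empty values are
allowed. -/
structure IsUsco {Y Z : Type*} [TopologicalSpace Y] [TopologicalSpace Z] (Φ : Y → Set Z) :
    Prop where
  upperHemicontinuous : UpperHemicontinuous Φ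
  isCompact : ∀ y, IsCompact (Φ y)

/-- A closed relation with a compact space is usco. The target `Z` is given together with a map
into the compact space that induces its topology, so that the relation may be viewed as taking
values in a subspace of a compact space, or in a power of such a subspace. -/
theorem IsUsco.of_isClosed_graph {Y Z K : Type*} [TopologicalSpace Y] [TopologicalSpace Z]
    [TopologicalSpace K] [CompactSpace K] {e : Z → K} (he : IsInducing e) {R : Set (Y × K)}
    (hR : IsClosed R) (hRe : ∀ p ∈ R, p.2 ∈ range e) : IsUsco fun y => {z | (y, e z) ∈ R} where
  upperHemicontinuous := by
    rw [upperHemicontinuous_iff_isClosed_compl_preimage_Iic_compl]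
    intro u hu
    obtain ⟨t, ht, rfl⟩ := he.isClosed_iff.mp hu
    convert isClosedMap_fst_of_compactSpace (X := Y) (Y := K) _
      (hR.inter (ht.preimage continuous_snd)) using 1
    ext y
    constructor
    · intro hy
      obtain ⟨z, hz, hzt⟩ := Set.not_subset.mp hy
      exact ⟨(y, e z), ⟨hz, not_not.mp hzt⟩, rfl⟩
    · rintro ⟨⟨y, k⟩, ⟨hyk, hkt⟩, rfl⟩ hsub
      obtain ⟨z, rfl⟩ := hRe _ hyk
      exact hsub hyk hkt
  isCompact y := by
    have hc : IsClosed {k | (y, k) ∈ R} := hR.preimage (by fun_prop)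
    exact he.isCompact_preimage' hc.isCompact fun k hk => hRe _ hk

theorem IsUsco.isCompact_biUnion {Y Z : Type*} [TopologicalSpace Y] [TopologicalSpace Z]
    {Φ : Y → Set Z} (hΦ : IsUsco Φ) {C : Set Y} (hC : IsCompact C) :
    IsCompact (⋃ y ∈ C, Φ y) := by
  rw [isCompact_iff_finite_subcover]
  intro ι U hU hcov
  have hfin : ∀ y ∈ C, ∃ t : Finset ι, Φ y ⊆ ⋃ i ∈ t, U i := fun y hy =>
    (hΦ.isCompact y).elim_finite_subcover U hU ((subset_biUnion_of_mem hy).trans hcov)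
  choose! t ht using hfin
  have hopen : ∀ s : Finset ι, IsOpen {y | Φ y ⊆ ⋃ i ∈ s, U i} := fun s =>
    upperHemicontinuous_iff_isOpen_preimage_Iic.mp hΦ.upperHemicontinuous _
      (isOpen_biUnion fun i _ => hU i)
  obtain ⟨s, hsC, hs⟩ := hC.elim_nhds_subcover (fun y => {y' | Φ y' ⊆ ⋃ i ∈ t y, U i})
    fun y hy => (hopen _).mem_nhds (ht y hy)
  classical
  refine ⟨s.biUnion t, iUnion₂_subset fun y hy => ?_⟩
  obtain ⟨y₀, hy₀, hyy₀⟩ := mem_iUnion₂.mp (hs hy)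
  refine Subset.trans hyy₀ (iUnion₂_subset fun i hi => ?_)
  exact subset_biUnion_of_mem (u := U) (Finset.mem_coe.mpr (Finset.mem_biUnion.mpr ⟨y₀, hy₀, hi⟩))

/-- A topological property that all compact spaces have, and that is inherited by each space
covered by the values of countably many usco maps from spaces with the property. -/
structure StableUnderUsco (P : ∀ (Y : Type) [TopologicalSpace Y], Prop) : Prop where
  of_compactSpace : ∀ (Y : Type) [TopologicalSpace Y] [CompactSpace Y], P Y
  of_usco : ∀ {ι : Type} [Countable ι] {Y : ι → Type} [∀ i, TopologicalSpace (Y i)] {Z : Type}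
    [TopologicalSpace Z] {Φ : ∀ i, Y i → Set Z}, (∀ i, IsUsco (Φ i)) →
    (∀ z, ∃ i y, z ∈ Φ i y) → (∀ i, P (Y i)) → P Z

theorem sigmaCompact_stableUnderUsco : StableUnderUsco fun Y _ => SigmaCompactSpace Y where
  of_compactSpace _ _ _ := inferInstance
  of_usco {ι _ Y _ Z _ Φ} hΦ hcov hY := by
    have hunion : (⋃ i, ⋃ k, ⋃ y ∈ compactCovering (Y i) k, Φ i y) = univ := by
      refine eq_univ_of_forall fun z => ?_
      obtain ⟨i, y, hz⟩ := hcov z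
      obtain ⟨k, hk⟩ := exists_mem_compactCovering y
      simp only [mem_iUnion]
      exact ⟨i, k, y, hk, hz⟩
    rw [← isSigmaCompact_univ_iff, ← hunion]
    exact isSigmaCompact_iUnion _ fun i => isSigmaCompact_iUnion_of_isCompact _ fun k =>
      (hΦ i).isCompact_biUnion (isCompact_compactCovering _ k)

/-! ### Selection principles -/

/-- The common form of the Menger and Hurewicz properties: from every sequence of open covers one
can choose finite subfamilies such that, for each point, the set of those `n` for which the `n`-th
subfamily covers the point belongs to `𝒢`. -/
def SelectsCovers (𝒢 : Set (Set ℕ)) (Y : Type*) [TopologicalSpace Y] : Prop :=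
  ∀ U : ℕ → Set (Set Y), (∀ n, IsCoverByOpens (U n)) →
    ∃ V : ℕ → Set (Set Y), (∀ n, V n ⊆ U n ∧ (V n).Finite) ∧ ∀ y, {n | y ∈ ⋃₀ V n} ∈ 𝒢

theorem isMenger_iff_selectsCovers {Y : Type*} [TopologicalSpace Y] :
    IsMenger Y ↔ SelectsCovers {s | s.Nonempty} Y := by
  refine forall₂_congr fun U hU => exists_congr fun V => and_congr_right fun hV => ?_
  have hopen : ∀ u ∈ ⋃ n, V n, IsOpen u := by
    intro u hu
    obtain ⟨n, hn⟩ := mem_iUnion.mp hu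
    exact (hU n).1 u ((hV n).1 hn)
  rw [IsCoverByOpens, and_iff_right hopen, sUnion_iUnion, eq_univ_iff_forall]
  simp only [mem_iUnion]
  rfl

theorem isHurewicz_iff_selectsCovers {Y : Type*} [TopologicalSpace Y] :
    IsHurewicz Y ↔ SelectsCovers {s | sᶜ.Finite} Y :=
  Iff.rfl

theorem IsCompact.exists_finite_subset_sUnion {Z : Type*} [TopologicalSpace Z] {C : Set Z}
    (hC : IsCompact C) {U : Set (Set Z)} (hU : IsCoverByOpens U) :
    ∃ v ⊆ U, v.Finite ∧ C ⊆ ⋃₀ v := by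
  simp only [sUnion_eq_biUnion]
  refine hC.elim_finite_subcover_image hU.1 ?_
  rw [← sUnion_eq_biUnion, hU.2]
  exact subset_univ C

theorem SelectsCovers.of_compactSpace {𝒢 : Set (Set ℕ)} (h𝒢 : univ ∈ 𝒢) (Y : Type*)
    [TopologicalSpace Y] [CompactSpace Y] : SelectsCovers 𝒢 Y := by
  intro U hU
  have hfin : ∀ n, ∃ V ⊆ U n, V.Finite ∧ univ ⊆ ⋃₀ V := fun n =>
    isCompact_univ.exists_finite_subset_sUnion (hU n)
  choose V hVU hVfin hV using hfin
  refine ⟨V, fun n => ⟨hVU n, hVfin n⟩, fun y => ?_⟩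
  convert h𝒢
  exact eq_univ_of_forall fun n => hV n (mem_univ y)

/-- An open cover of the target of a usco map induces an open cover of the source, by open sets on
which finitely many members of the given cover suffice to cover all the values. -/
theorem IsUsco.isCoverByOpens {Y Z : Type*} [TopologicalSpace Y] [TopologicalSpace Z]
    {Φ : Y → Set Z} (hΦ : IsUsco Φ) {U : Set (Set Z)} (hU : IsCoverByOpens U) :
    IsCoverByOpens {o : Set Y | IsOpen o ∧ ∃ v ⊆ U, v.Finite ∧ ∀ y ∈ o, Φ y ⊆ ⋃₀ v} := by
  refine ⟨fun o ho => ho.1, eq_univ_of_forall fun y => ?_⟩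
  obtain ⟨v, hvU, hvfin, hv⟩ := (hΦ.isCompact y).exists_finite_subset_sUnion hU
  refine ⟨{y' | Φ y' ⊆ ⋃₀ v}, ⟨?_, v, hvU, hvfin, fun y' hy' => hy'⟩, hv⟩
  exact upperHemicontinuous_iff_isOpen_preimage_Iic.mp hΦ.upperHemicontinuous _
    (isOpen_sUnion fun u hu => hU.1 u (hvU hu))

/-- The hypothesis on `𝒢` says that it is closed under supersets and under translations. The
translations allow a countable union to be handled by using, for the source with number `m`, only
the covers from the `m`-th on, so that each single cover is used finitely many times. -/
theorem SelectsCovers.of_usco {𝒢 : Set (Set ℕ)}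
    (h𝒢 : ∀ s ∈ 𝒢, ∀ (m : ℕ) (t : Set ℕ), (∀ n ∈ s, n + m ∈ t) → t ∈ 𝒢)
    {ι : Type*} [Countable ι] {Y : ι → Type*} [∀ i, TopologicalSpace (Y i)] {Z : Type*}
    [TopologicalSpace Z] {Φ : ∀ i, Y i → Set Z} (hΦ : ∀ i, IsUsco (Φ i))
    (hcov : ∀ z, ∃ i y, z ∈ Φ i y) (hY : ∀ i, SelectsCovers 𝒢 (Y i)) : SelectsCovers 𝒢 Z := by
  intro U hU
  obtain ⟨c, hc⟩ := exists_injective_nat ι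
  choose W hW hWsel using fun i => hY i _ fun k => (hΦ i).isCoverByOpens (hU (k + c i))
  have hsub : ∀ i k, ∀ o ∈ W i k,
      ∃ v ⊆ U (k + c i), v.Finite ∧ ∀ y ∈ o, Φ i y ⊆ ⋃₀ v := fun i k o ho => ((hW i k).1 ho).2
  choose! v hvU hvfin hv using hsub
  refine ⟨fun n => ⋃ i ∈ {i | c i ≤ n}, ⋃ o ∈ W i (n - c i), v i (n - c i) o, fun n => ⟨?_, ?_⟩,
    fun z => ?_⟩
  · refine iUnion₂_subset fun i hi => iUnion₂_subset fun o ho => ?_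
    have := hvU i _ o ho
    rwa [Nat.sub_add_cancel hi] at this
  · refine Finite.biUnion ((finite_Iic n).preimage hc.injOn) fun i _ => ?_
    exact Finite.biUnion (hW i _).2 fun o ho => hvfin i _ o ho
  · obtain ⟨i, y, hz⟩ := hcov z
    refine h𝒢 _ (hWsel i y) (c i) _ ?_
    rintro k ⟨o, ho, hyo⟩
    obtain ⟨u, hu, hzu⟩ := hv i k o ho y hyo hz
    refine ⟨u, ?_, hzu⟩
    simp only [mem_iUnion]
    refine ⟨i, Nat.le_add_left _ _, o, ?_⟩
    rw [Nat.add_sub_cancel]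
    exact ⟨ho, hu⟩

theorem isMenger_stableUnderUsco : StableUnderUsco fun Y _ => IsMenger Y := by
  simp only [isMenger_iff_selectsCovers]
  refine ⟨fun Y => SelectsCovers.of_compactSpace univ_nonempty Y, SelectsCovers.of_usco ?_⟩
  rintro s ⟨n, hn⟩ m t h
  exact ⟨n + m, h n hn⟩

theorem isHurewicz_stableUnderUsco : StableUnderUsco fun Y _ => IsHurewicz Y := by
  simp only [isHurewicz_iff_selectsCovers]
  refine ⟨fun Y => SelectsCovers.of_compactSpace (by simp) Y, SelectsCovers.of_usco ?_⟩
  intro s hs m t h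
  refine ((finite_Iio m).union (hs.image (· + m))).subset fun n hn => ?_
  rcases lt_or_ge n m with hnm | hmn
  · exact Or.inl hnm
  · refine Or.inr ⟨n - m, fun hns => hn ?_, Nat.sub_add_cancel hmn⟩
    simpa only [Nat.sub_add_cancel hmn] using h _ hns

/-! ### Branches -/

theorem mem_branch_iff {t : BinTree} {x : ℕ → Bool} :
    t ∈ branch x ↔ restrictTo x t.1 = t := by
  constructor
  · rintro ⟨n, rfl⟩
    rfl
  · exact fun h => ⟨_, h⟩

theorem restrictTo_injective (x : ℕ → Bool) : Function.Injective (restrictTo x) :=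
  fun _ _ h => congrArg Sigma.fst h

theorem isClopen_setOf_mem_branch (t : BinTree) : IsClopen {x | t ∈ branch x} := by
  have heq : {x | t ∈ branch x} = (fun (x : ℕ → Bool) (i : Fin t.1) => x i) ⁻¹' {t.2} := by
    ext x
    obtain ⟨n, s⟩ := t
    simp [mem_branch_iff, restrictTo]
  rw [heq]
  exact (isClopen_discrete _).preimage (by fun_prop)

/-- Two branches with infinite intersection are equal. -/
theorem finite_setOf_restrictTo_mem_branch {x y : ℕ → Bool} (hxy : x ≠ y) :
    {n | restrictTo y n ∈ branch x}.Finite := by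
  obtain ⟨d, hd⟩ := Function.ne_iff.mp hxy
  refine (finite_Iic d).subset fun n hn => ?_
  by_contra hdn
  have heq : restrictTo x n = restrictTo y n := mem_branch_iff.mp hn
  exact hd (congrFun (eq_of_heq (Sigma.mk.inj heq).2) ⟨d, not_le.mp hdn⟩)

theorem mem_of_branch_subset {y : ℕ → Bool} {E : Set BinTree} (hE : E.Finite)
    {s : Set (ℕ → Bool)} (hs : s.Finite) (h : branch y ⊆ E ∪ ⋃ x ∈ s, branch x) : y ∈ s := by
  by_contra hy
  have hfin : (restrictTo y ⁻¹' E ∪ ⋃ x ∈ s, {n | restrictTo y n ∈ branch x}).Finite :=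
    (hE.preimage (restrictTo_injective y).injOn).union <| hs.biUnion fun x hx =>
      finite_setOf_restrictTo_mem_branch (ne_of_mem_of_not_mem hx hy)
  refine infinite_univ (hfin.subset fun n _ => ?_)
  rcases h ⟨n, rfl⟩ with hn | hn
  · exact Or.inl hn
  · exact Or.inr (by simpa using hn)

/-! ### The filters -/

/-- `𝓔` is the family of finite sets that may be left out in addition to finitely many branches:
just `∅` for `F_X`, and all finite sets if the cofinite sets are adjoined. -/
theorem exists_mem_iff_compl_subset {X : Set (ℕ → Bool)} {F : Filter BinTree}
    (hF : F = nyikosFilter X ∨ F = nyikosFilter X ⊓ Filter.cofinite) :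
    ∃ 𝓔 : Set (Finset BinTree), ∅ ∈ 𝓔 ∧ ∀ A, A ∈ F ↔
      ∃ E ∈ 𝓔, ∃ s : Set (ℕ → Bool), s.Finite ∧ s ⊆ X ∧ Aᶜ ⊆ ↑E ∪ ⋃ x ∈ s, branch x := by
  rcases hF with rfl | rfl
  · refine ⟨{∅}, rfl, fun A => ?_⟩
    simp only [mem_singleton_iff, exists_eq_left, Finset.coe_empty, empty_union]
    rfl
  · refine ⟨univ, mem_univ _, fun A => ?_⟩
    rw [Filter.mem_inf_iff_superset]
    constructor
    · rintro ⟨B, ⟨s, hs, hsX, hB⟩, D, hD, hBD⟩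
      refine ⟨(Filter.mem_cofinite.mp hD).toFinset, mem_univ _, s, hs, hsX, ?_⟩
      rw [Finite.coe_toFinset]
      intro t ht
      by_cases htD : t ∈ D
      · exact Or.inr (hB fun htB => ht (hBD ⟨htB, htD⟩))
      · exact Or.inl htD
    · rintro ⟨E, -, s, hs, hsX, hA⟩
      refine ⟨(⋃ x ∈ s, branch x)ᶜ, ⟨s, hs, hsX, (compl_compl _).le⟩, (↑E : Set BinTree)ᶜ, ?_, ?_⟩
      · exact Filter.mem_cofinite.mpr (by simp)
      · rintro t ⟨hts, htE⟩
        by_contra htA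
        exact (hA htA).elim htE hts

theorem isClosed_setOf_compl_subset (n : ℕ) (E : Set BinTree) :
    IsClosed {p : (Fin n → ℕ → Bool) × (BinTree → Bool) |
      ∀ t, p.2 t = true ∨ t ∈ E ∨ ∃ i, t ∈ branch (p.1 i)} := by
  simp only [ofPred_forall, ofPred_or, ofPred_exists]
  refine isClosed_iInter fun t => IsClosed.union ?_ (isClosed_const.union ?_)
  · exact isClosed_eq (by fun_prop) continuous_const
  · exact isClosed_iUnion_of_finite fun i =>
      (isClopen_setOf_mem_branch t).isClosed.preimage (by fun_prop)

theorem isClosed_setOf_compl_eq (n : ℕ) :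
    IsClosed {p : (BinTree → Bool) × (Fin n → ℕ → Bool) |
      ∀ t, p.1 t = false ↔ ∃ i, t ∈ branch (p.2 i)} := by
  rw [ofPred_forall]
  refine isClosed_iInter fun t => ?_
  have h₁ : IsClopen {p : (BinTree → Bool) × (Fin n → ℕ → Bool) | p.1 t = false} :=
    (isClopen_discrete {false}).preimage
      (f := fun p : (BinTree → Bool) × (Fin n → ℕ → Bool) => p.1 t) (by fun_prop)
  have h₂ : IsClopen {p : (BinTree → Bool) × (Fin n → ℕ → Bool) | ∃ i, t ∈ branch (p.2 i)} := by
    rw [ofPred_exists]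
    exact isClopen_iUnion_of_finite fun i => (isClopen_setOf_mem_branch t).preimage (by fun_prop)
  convert ((h₁.inter h₂).union (h₁.compl.inter h₂.compl)).isClosed using 1
  ext p
  exact iff_iff_and_or_not_and_not

theorem StableUnderUsco.forall_pow_iff {P : ∀ (Y : Type) [TopologicalSpace Y], Prop}
    (hP : StableUnderUsco P) {X : Set (ℕ → Bool)} {F : Filter BinTree}
    (hF : F = nyikosFilter X ∨ F = nyikosFilter X ⊓ Filter.cofinite) :
    (∀ n : ℕ, 0 < n → P (Fin n → X)) ↔ P (filterSubspace F) := by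
  obtain ⟨𝓔, h𝓔, hmem⟩ := exists_mem_iff_compl_subset hF
  constructor
  · intro h
    -- The case `n = 0` is needed if `X` is empty.
    have hall : ∀ n, P (Fin n → X) := fun n => by
      rcases n.eq_zero_or_pos with rfl | hn
      · exact hP.of_compactSpace _
      · exact h n hn
    refine hP.of_usco (ι := ℕ × 𝓔) (Y := fun j => Fin j.1 → X) (Φ := fun j x =>
      {f | ∀ t, f.1 t = true ∨ t ∈ (j.2.1 : Set BinTree) ∨ ∃ i, t ∈ branch (x i)}) ?_ ?_
      fun j => hall j.1
    · rintro ⟨n, E, hE⟩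
      refine IsUsco.of_isClosed_graph IsInducing.subtypeVal
        (R := {p : (Fin n → X) × (BinTree → Bool) |
          ∀ t, p.2 t = true ∨ t ∈ (E : Set BinTree) ∨ ∃ i, t ∈ branch (p.1 i)}) ?_ ?_
      · exact (isClosed_setOf_compl_subset n E).preimage
          (f := fun p : (Fin n → X) × (BinTree → Bool) => (fun i => (p.1 i : ℕ → Bool), p.2))
          (by fun_prop)
      · rintro ⟨x, f⟩ hxf
        refine ⟨⟨f, (hmem _).mpr ⟨E, hE, range fun i => (x i : ℕ → Bool), finite_range _,
          range_subset_iff.mpr fun i => (x i).2, fun t ht => ?_⟩⟩, rfl⟩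
        rcases hxf t with h | h | ⟨i, hi⟩
        · exact absurd h ht
        · exact Or.inl h
        · exact Or.inr (mem_biUnion (mem_range_self i) hi)
    · rintro ⟨f, hf⟩
      obtain ⟨E, hE, s, hs, hsX, hfs⟩ := (hmem _).mp hf
      obtain ⟨n, x, hx⟩ := hs.fin_param
      have hxs : ∀ i, x i ∈ s := fun i => hx.2 ▸ mem_range_self i
      refine ⟨(n, ⟨E, hE⟩), fun i => ⟨x i, hsX (hxs i)⟩, fun t => ?_⟩
      by_cases hft : f t = true
      · exact Or.inl hft
      · refine Or.inr ((hfs hft).imp_right fun ht => ?_)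
        rw [← hx.2, biUnion_range] at ht
        exact mem_iUnion.mp ht
  · intro h n _
    refine hP.of_usco (ι := Unit) (Y := fun _ => filterSubspace F) (Φ := fun _ f =>
      {x | ∀ t, f.1 t = false ↔ ∃ i, t ∈ branch (x i)}) (fun _ => ?_) ?_ fun _ => h
    · refine IsUsco.of_isClosed_graph
        (IsInducing.piMap (f := fun (_ : Fin n) (x : X) => (x : ℕ → Bool)) fun _ =>
          IsInducing.subtypeVal)
        (R := {p : filterSubspace F × (Fin n → ℕ → Bool) |
          ∀ t, p.1.1 t = false ↔ ∃ i, t ∈ branch (p.2 i)}) ?_ ?_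
      · exact (isClosed_setOf_compl_eq n).preimage
          (f := fun p : filterSubspace F × (Fin n → ℕ → Bool) => (p.1.1, p.2)) (by fun_prop)
      · rintro ⟨⟨f, hf⟩, x⟩ hfx
        obtain ⟨E, -, s, hs, hsX, hfs⟩ := (hmem _).mp hf
        refine ⟨fun i => ⟨x i, hsX (mem_of_branch_subset E.finite_toSet hs fun t ht => hfs ?_)⟩, rfl⟩
        have : f t = false := (hfx t).mpr ⟨i, ht⟩
        simp [this]
    · intro x
      classical
      refine ⟨(), ⟨fun t => !decide (∃ i, t ∈ branch (x i)), ?_⟩, fun t => by simp⟩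
      refine (hmem _).mpr ⟨∅, h𝓔, range fun i => (x i : ℕ → Bool), finite_range _,
        range_subset_iff.mpr fun i => (x i).2, fun t ht => Or.inr ?_⟩
      simpa using ht

/-! ### `F_σ` sets -/

theorem isFSigma_iff_sigmaCompactSpace {K : Type*} [TopologicalSpace K] [CompactSpace K]
    [T2Space K] {S : Set K} : IsFSigma S ↔ SigmaCompactSpace S := by
  rw [← isSigmaCompact_iff_sigmaCompactSpace]
  exact exists_congr fun C => and_congr
    (forall_congr' fun n => ⟨IsClosed.isCompact, IsCompact.isClosed⟩) eq_comm

theorem forall_pow_sigmaCompactSpace_iff {Y : Type*} [TopologicalSpace Y] :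
    (∀ n : ℕ, 0 < n → SigmaCompactSpace (Fin n → Y)) ↔ SigmaCompactSpace Y := by
  refine ⟨fun h => ?_, fun h n _ => inferInstance⟩
  have := h 1 one_pos
  have hs := isSigmaCompact_range (Homeomorph.funUnique (Fin 1) Y).continuous
  rwa [(Homeomorph.funUnique (Fin 1) Y).range_coe, isSigmaCompact_univ_iff] at hs

/-- `F` is the filter `F_X`, or `F_X` with the cofinite sets adjoined. -/
theorem theorem3p2 (X : Set (ℕ → Bool)) (F : Filter BinTree)
    (hF : F = nyikosFilter X ∨ F = nyikosFilter X ⊓ Filter.cofinite) :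
    (IsFSigma X ↔ IsFSigma (filterSubspace F)) ∧
    ((∀ n : ℕ, 0 < n → IsMenger (Fin n → X)) ↔ IsMenger (filterSubspace F)) ∧
    ((∀ n : ℕ, 0 < n → IsHurewicz (Fin n → X)) ↔ IsHurewicz (filterSubspace F)) := by
  refine ⟨?_, isMenger_stableUnderUsco.forall_pow_iff hF,
    isHurewicz_stableUnderUsco.forall_pow_iff hF⟩
  rw [isFSigma_iff_sigmaCompactSpace, isFSigma_iff_sigmaCompactSpace,
    ← forall_pow_sigmaCompactSpace_iff (Y := X)]
  exact sigmaCompact_stableUnderUsco.forall_pow_iff hF
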